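/- Let $M$ be a Garside monoid: a finitely generated cancellative monoid which is atomic (there is $\nu:M\to\mathbb N$ with $\nu(a)=0\Leftrightarrow a=1$ and $\nu(ab)\ge\nu(a)+\nu(b)$), whose left divisibility order ($a\le_L b$ iff $b\in aM$) and right divisibility order ($a\le_R b$ iff $b\in Ma$) are both lattice orders, and which has a Garside element, i.e. an element whose left divisors and right divisors form the same set, this set generating $M$. Fix a Garside element $\Delta$, let $\mathcal S=\{a\in M: a\le_L\Delta\}$ be the set of simple elements, write $\wedge_L$ for the meet of $(M,\le_L)$, and let $G=G(M)$ be the group of fractions of $M$ (the group presented by the generating set $M$ and the relations $a\cdot b=c$ whenever $ab=c$ in $M$). For $a\in\mathcal S$ let $a^*\in\mathcal S$ be the element with $aa^*=\Delta$, and let $\tau$ be the permutation $a\mapsto\Delta a\Delta^{-1}$ of $\mathcal S$. The $\Delta$-normal form of $\gamma\in G$ is the expression $\gamma=\Delta^p c_1\cdots c_r$ in which $p\in\mathbb Z$ is the maximal integer with $\Delta^{-p}\gamma\in M$, and $c_1,\dots,c_r$ are nontrivial simple elements with $c_i=\Delta\wedge_L(c_ic_{i+1}\cdots c_r)$ for $1\le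 i\le r$. If $\alpha=\Delta^p a_1\cdots a_r$ is the $\Delta$-normal form of $\alpha\in G$, put $i(\alpha)=\tau^p(a_1)$ and $t(\alpha)=a_r$ (and $i(\alpha)=1$, $t(\alpha)=\Delta$ if $r=0$), $\pi(\alpha)=i(\alpha)\wedge_L t(\alpha)^*$, and let the sliding of $\alpha$ be $S(\alpha)=\pi(\alpha)^{-1}\alpha\,\pi(\alpha)$. (If $M$ is trivial, $S$ is the identity of the trivial group $G$.) The set of sliding circuits of $\alpha$ is $$SC(\alpha)=\{\beta\in G:\ \beta \text{ is conjugate to } \alpha \text{ and } S^m(\beta)=\beta \text{ for some } m\ge 1\}.$$ **Corollary.** Let $\alpha,\beta,\gamma\in G$ be such that $\beta$ and $\gamma^{-1}\beta\gamma$ are elements of $SC(\alpha)$. Let $\gamma=\Delta^p c_1c_2\cdots c_r$ be the $\Delta$-normal form of $\gamma$. Set $\beta_0=\Delta^{-p}\beta\Delta^p$ and $\beta_i=c_i^{-1}\beta_{i-1}c_i$ for $1\le i\le r$. Then $\beta_i\in SC(\alpha)$ for all $0\le i\le r$. -/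

import Mathlib

namespace Garside

/-! ### Garside monoids -/

section Monoid

variable {M : Type*} [Monoid M]

/-- A monoid is atomic if it carries a norm `ν : M → ℕ`. -/
def IsAtomicMonoid (M : Type*) [Monoid M] : Prop :=
  ∃ ν : M → ℕ, (∀ a, ν a = 0 ↔ a = 1) ∧ ∀ a b, ν a + ν b ≤ ν (a * b)

/-- The left divisibility order. -/
def LeL (a b : M) : Prop := ∃ c, a * c = b

/-- The right divisibility order. -/
def LeR (a b : M) : Prop := ∃ c, c * a = b

/-- `d` is the greatest lower bound of `a` and `b` for the relation `r`. -/
def IsMeet {X : Type*} (r : X → X → Prop) (a b d : X) : Prop :=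
  r d a ∧ r d b ∧ ∀ e, r e a → r e b → r e d

/-- `d` is the least upper bound of `a` and `b` for the relation `r`. -/
def IsJoin {X : Type*} (r : X → X → Prop) (a b d : X) : Prop :=
  r a d ∧ r b d ∧ ∀ e, r a e → r b e → r d e

/-- The relation `r` is a lattice order. -/
structure IsLatticeOrder {X : Type*} (r : X → X → Prop) : Prop where
  refl : ∀ a, r a a
  trans : ∀ a b c, r a b → r b c → r a c
  antisymm : ∀ a b, r a b → r b a → a = b
  exists_meet : ∀ a b, ∃ d, IsMeet r a b d
  exists_join : ∀ a b, ∃ d, IsJoin r a b d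

/-- `Δ` is a Garside element: its left divisors and its right divisors are the same elements,
and they generate the monoid. -/
structure IsGarsideElement (Δ : M) : Prop where
  leL_iff_leR : ∀ a, LeL a Δ ↔ LeR a Δ
  closure_eq_top : Submonoid.closure {a | LeL a Δ} = ⊤

/-- Garside monoids. -/
class IsGarsideMonoid (M : Type*) [Monoid M] : Prop extends IsCancelMul M where
  atomic : IsAtomicMonoid M
  fg : Monoid.FG M
  latticeL : IsLatticeOrder (LeL : M → M → Prop)
  latticeR : IsLatticeOrder (LeR : M → M → Prop)
  exists_garsideElement : ∃ Δ : M, IsGarsideElement Δ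

/-- The meet `a ∧_L b` in a Garside monoid. -/
noncomputable def meetL [IsGarsideMonoid M] (a b : M) : M :=
  Classical.choose ((IsGarsideMonoid.latticeL (M := M)).exists_meet a b)

theorem isMeet_meetL [IsGarsideMonoid M] (a b : M) : IsMeet LeL a b (meetL a b) :=
  Classical.choose_spec ((IsGarsideMonoid.latticeL (M := M)).exists_meet a b)

/-- The set `𝒮` of simple elements: the (left) divisors of `Δ`. -/
abbrev Simple (Δ : M) : Type _ := {a : M // LeL a Δ}

/-- `1` as a simple element. -/
def Simple.one (Δ : M) : Simple Δ := ⟨1, Δ, one_mul Δ⟩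

/-- `Δ` as a simple element. -/
def Simple.top (Δ : M) : Simple Δ := ⟨Δ, 1, mul_one Δ⟩

theorem IsGarsideElement.exists_star {Δ : M} (hΔ : IsGarsideElement Δ) (a : Simple Δ) :
    ∃ b : Simple Δ, (a : M) * b = Δ := by
  obtain ⟨a, s, hs⟩ := a
  exact ⟨⟨s, (hΔ.leL_iff_leR s).2 ⟨a, hs⟩⟩, hs⟩

theorem IsGarsideElement.exists_tau {Δ : M} (hΔ : IsGarsideElement Δ) (a : Simple Δ) :
    ∃ b : Simple Δ, Δ * (a : M) = b * Δ := by
  obtain ⟨s, hs⟩ := (hΔ.leL_iff_leR _).1 a.2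
  obtain ⟨u, hu⟩ := (hΔ.leL_iff_leR s).1 ⟨a, hs⟩
  refine ⟨⟨u, s, hu⟩, ?_⟩
  calc Δ * (a : M) = u * s * a := by rw [hu]
    _ = u * Δ := by rw [mul_assoc, hs]

theorem IsGarsideElement.exists_tau_symm {Δ : M} (hΔ : IsGarsideElement Δ) (b : Simple Δ) :
    ∃ a : Simple Δ, Δ * (a : M) = b * Δ := by
  obtain ⟨s, hs⟩ := b.2
  obtain ⟨u, hu⟩ := (hΔ.leL_iff_leR s).2 ⟨b, hs⟩
  refine ⟨⟨u, (hΔ.leL_iff_leR u).2 ⟨s, hu⟩⟩, ?_⟩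
  calc Δ * u = b * s * u := by rw [hs]
    _ = b * Δ := by rw [mul_assoc, hu]

/-- For a simple element `a`, the (unique) simple element `a^*` with `a a^* = Δ`. -/
noncomputable def star {Δ : M} (hΔ : IsGarsideElement Δ) (a : Simple Δ) : Simple Δ :=
  Classical.choose (hΔ.exists_star a)

theorem mul_star {Δ : M} (hΔ : IsGarsideElement Δ) (a : Simple Δ) :
    (a : M) * star hΔ a = Δ :=
  Classical.choose_spec (hΔ.exists_star a)

/-- The permutation `τ` of the simple elements given by `τ(a) = Δ a Δ⁻¹`. -/
noncomputable def tau [IsGarsideMonoid M] {Δ : M} (hΔ : IsGarsideElement Δ) :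
    Equiv.Perm (Simple Δ) where
  toFun a := Classical.choose (hΔ.exists_tau a)
  invFun b := Classical.choose (hΔ.exists_tau_symm b)
  left_inv a := Subtype.ext <| mul_left_cancel <|
    (Classical.choose_spec (hΔ.exists_tau_symm (Classical.choose (hΔ.exists_tau a)))).trans
      (Classical.choose_spec (hΔ.exists_tau a)).symm
  right_inv b := Subtype.ext <| mul_right_cancel <|
    (Classical.choose_spec (hΔ.exists_tau (Classical.choose (hΔ.exists_tau_symm b)))).symm.trans
      (Classical.choose_spec (hΔ.exists_tau_symm b))

theorem tau_spec [IsGarsideMonoid M] {Δ : M} (hΔ : IsGarsideElement Δ) (a : Simple Δ) :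
    Δ * (a : M) = tau hΔ a * Δ :=
  Classical.choose_spec (hΔ.exists_tau a)

/-- The product in `M` of a list of simple elements. -/
def prod {Δ : M} (c : List (Simple Δ)) : M := (c.map Subtype.val).prod

/-- `s = [a_1, …, a_l]` is a normal form: the `a_i` are nontrivial simple elements with
`a_i = Δ ∧_L (a_i a_{i+1} ⋯ a_l)` for all `i`. -/
def IsNormalForm [IsGarsideMonoid M] {Δ : M} (s : List (Simple Δ)) : Prop :=
  ∀ (i : ℕ) (hi : i < s.length),
    (s[i] : M) ≠ 1 ∧ (s[i] : M) = meetL Δ (prod (s.drop i))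

end Monoid

/-! ### The group of fractions -/

/-- The group of fractions `G(M)`: the group presented by the generating set `M` and the
relations `a · b = c` whenever `a b = c` in `M`. -/
abbrev FractionGroup (M : Type*) [Monoid M] : Type _ :=
  PresentedGroup {w : FreeGroup M | ∃ a b c : M, a * b = c ∧
    w = FreeGroup.of a * FreeGroup.of b * (FreeGroup.of c)⁻¹}

section Group

variable {M : Type*} [Monoid M]

theorem of_mul_of (a b : M) :
    (PresentedGroup.of a * PresentedGroup.of b : FractionGroup M) =
      PresentedGroup.of (a * b) := by
  have h := PresentedGroup.one_of_mem
    (rels := {w : FreeGroup M | ∃ a b c : M, a * b = c ∧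
      w = FreeGroup.of a * FreeGroup.of b * (FreeGroup.of c)⁻¹})
    (x := FreeGroup.of a * FreeGroup.of b * (FreeGroup.of (a * b))⁻¹) ⟨a, b, _, rfl, rfl⟩
  rw [map_mul, map_mul, map_inv] at h
  exact mul_inv_eq_one.1 h

/-- The natural homomorphism `ι : M → G(M)`. -/
def incl (M : Type*) [Monoid M] : M →* FractionGroup M where
  toFun a := PresentedGroup.of a
  map_one' := by
    have h := of_mul_of (1 : M) 1
    rw [mul_one] at h
    exact mul_eq_left.1 h
  map_mul' a b := (of_mul_of a b).symm

variable [IsGarsideMonoid M]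

/-- `α = Δ^p c_1 ⋯ c_r` is the `Δ`-normal form of `α`: one has `α = Δ^p β` with `β ∈ M` and `p`
maximal, and `c_1 ⋯ c_r` is the normal form of `β`. -/
structure IsDeltaNormalForm {Δ : M} (α : FractionGroup M) (p : ℤ) (c : List (Simple Δ)) :
    Prop where
  eq : α = incl M Δ ^ p * incl M (prod c)
  le_of_eq : ∀ (q : ℤ) (β : M), α = incl M Δ ^ q * incl M β → q ≤ p
  normalForm : IsNormalForm c

open Classical in
/-- The `Δ`-normal form of `α`, as the pair of the exponent `p` and the list of factors.
It exists and is unique as soon as `M` is nontrivial; for trivial `M`, where no exponent is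
maximal, we take the empty expression. -/
noncomputable def deltaNormalForm (Δ : M) (α : FractionGroup M) : ℤ × List (Simple Δ) :=
  if h : ∃ x : ℤ × List (Simple Δ), IsDeltaNormalForm α x.1 x.2 then Classical.choose h
  else (0, [])

variable {Δ : M} (hΔ : IsGarsideElement Δ)

/-- The initial factor `i(α) = τ^p(a_1)`, where `Δ^p a_1 ⋯ a_r` is the `Δ`-normal form of `α`;
by the usual convention it is `1` if `r = 0`. -/
noncomputable def initialFactor (α : FractionGroup M) : Simple Δ :=
  match (deltaNormalForm Δ α).2 with
  | [] => Simple.one Δ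
  | a :: _ => (tau hΔ ^ (deltaNormalForm Δ α).1) a

/-- The terminal factor `t(α) = a_r`, where `Δ^p a_1 ⋯ a_r` is the `Δ`-normal form of `α`;
by the usual convention it is `Δ` if `r = 0`. -/
noncomputable def terminalFactor (Δ : M) (α : FractionGroup M) : Simple Δ :=
  (deltaNormalForm Δ α).2.getLastD (Simple.top Δ)

/-- `π(α) = i(α) ∧_L t(α)^*`. -/
noncomputable def slidingPrefix (α : FractionGroup M) : M :=
  meetL (initialFactor hΔ α : M) (star hΔ (terminalFactor Δ α))

/-- The sliding `S(α) = π(α)⁻¹ α π(α)`. -/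
noncomputable def sliding (α : FractionGroup M) : FractionGroup M :=
  (incl M (slidingPrefix hΔ α))⁻¹ * α * incl M (slidingPrefix hΔ α)

/-- The set `SC(α)` of sliding circuits of `α`: the conjugates `β` of `α` such that
`S^m(β) = β` for some `m ≥ 1`. -/
def slidingCircuits (α : FractionGroup M) : Set (FractionGroup M) :=
  {β | IsConj β α ∧ ∃ m : ℕ, 1 ≤ m ∧ (sliding hΔ)^[m] β = β}

end Group

end Garside

namespace Garside

/-! The group of fractions is ordered by left divisibility; this order has meets, is invariant under
left multiplication, and is invariant under right multiplication by powers of `Δ`. Fix `x = β` on a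
sliding circuit and consider the set of those `a` for which `a⁻¹ x a` lies on a circuit. If this set
is closed under right multiplication by `Δ ^ n` and under meets (`IsCircuit.conj_mul_zpow`,
`IsCircuit.conj_inf`), the result follows by induction: for `g = Δ^p c_1 ⋯ c_i`, normality of the
form gives `g c_{i+1} = gΔ ⊓ γ`.

For the closure properties, sliding is lifted from conjugates to conjugators. If `a⁻¹ x a` has
infimum `p` and supremum `q`, its sliding is the conjugate of `x` by `slide Δ x p q a`
(`HasBounds.sliding_conj`). With `p` and `q` held fixed, this lift preserves meets and commutes with
right multiplication by powers of `Δ` and with left multiplication by the centralizer of `x`.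
Holding them fixed is legitimate because infimum and supremum are extremal in the conjugacy class on
every circuit (`RightMono.not_mul_zpow_le`), hence are the same on all circuits of the class.

Lying on a circuit then means that an iterate of the lift sends `a` to `u * a` with `u` centralizing
`x`. A finiteness argument (`RightMono.exists_iterate_eq`) makes `u` a power of one element
independent of `a`, so two conjugators share the same `u`, and so does their meet. -/

/-- Descending chains that are bounded below become stationary. -/
def BoundedDCC (X : Type*) [Preorder X] : Prop :=
  ∀ (b : X) (u : ℕ → X), (∀ n, u (n + 1) ≤ u n) → (∀ n, b ≤ u n) → ∃ n, u (n + 1) = u n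

theorem exists_iterate_fixed {X : Type*} [Preorder X] (hd : BoundedDCC X) {f : X → X} (hf : Monotone f)
    (hle : ∀ a, f a ≤ a) {a : X} (ha : f a = a) {b : X} (hab : a ≤ b) :
    ∃ n, f (f^[n] b) = f^[n] b := by
  have := hd a (fun n => f^[n] b) (fun n => by
    rw [Function.iterate_succ_apply']; exact hle _) (fun n => by
    rw [← Function.iterate_fixed ha n]; exact hf.iterate n hab)
  simpa only [Function.iterate_succ_apply'] using this

/-! ### Sliding lifted to conjugators, in an abstract ordered group -/

section OrderedGroup

variable {G : Type*} [Group G] [SemilatticeInf G]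

/-- The conjugating element of the sliding of `a⁻¹ x a`, multiplied on the left by `a`, when
`a⁻¹ x a` has infimum `p` and supremum `q`. -/
def slide (Δ x : G) (p q : ℤ) (a : G) : G :=
  x * a * Δ ^ (-p) ⊓ x⁻¹ * a * Δ ^ q ⊓ a * Δ

variable {Δ : G}

/-- Right multiplication by powers of `Δ` is monotone. -/
def RightMono (Δ : G) : Prop := ∀ (n : ℤ) (a b : G), a ≤ b → a * Δ ^ n ≤ b * Δ ^ n

theorem RightMono.mul_le_iff (h : RightMono Δ) (n : ℤ) {a b : G} :
    a * Δ ^ n ≤ b * Δ ^ n ↔ a ≤ b :=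
  ⟨fun hab => by simpa [mul_assoc] using h (-n) _ _ hab, h n a b⟩

theorem RightMono.inf_mul (h : RightMono Δ) (n : ℤ) (a b : G) :
    (a ⊓ b) * Δ ^ n = a * Δ ^ n ⊓ b * Δ ^ n := by
  apply le_antisymm
  · exact le_inf (h n _ _ inf_le_left) (h n _ _ inf_le_right)
  · have h1 := h (-n) _ _ (inf_le_left : a * Δ ^ n ⊓ b * Δ ^ n ≤ _)
    have h2 := h (-n) _ _ (inf_le_right : a * Δ ^ n ⊓ b * Δ ^ n ≤ _)
    rw [mul_assoc, ← zpow_add, add_neg_cancel, zpow_zero, mul_one] at h1 h2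
    simpa [mul_assoc] using h n _ _ (le_inf h1 h2)

theorem RightMono.inf_mul_self (h : RightMono Δ) (a b : G) :
    (a ⊓ b) * Δ = a * Δ ⊓ b * Δ := by
  simpa using h.inf_mul 1 a b

theorem RightMono.zpow_le_zpow (h : RightMono Δ) (h1 : 1 ≤ Δ) {m n : ℤ} (hmn : m ≤ n) :
    Δ ^ m ≤ Δ ^ n := by
  obtain ⟨k, rfl⟩ := Int.le.dest hmn
  induction k with
  | zero => simp
  | succ k ih =>
    refine (ih (by lia)).trans ?_
    have := h (m + k) _ _ h1
    rwa [one_mul, ← zpow_one_add, show (1 : ℤ) + (m + k) = m + (k + 1 : ℕ) by push_cast; ring]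
      at this

variable {x : G} {p q : ℤ}

theorem RightMono.slide_mul_zpow (h : RightMono Δ) (a : G) (n : ℤ) :
    slide Δ x p q (a * Δ ^ n) = slide Δ x p q a * Δ ^ n := by
  simp only [slide, h.inf_mul]
  simp only [mul_assoc, ← zpow_add, ← zpow_add_one, ← zpow_one_add, add_comm]

theorem RightMono.slide_iterate_mul_zpow (h : RightMono Δ) (n : ℕ) (a : G) (m : ℤ) :
    (slide Δ x p q)^[n] (a * Δ ^ m) = (slide Δ x p q)^[n] a * Δ ^ m := by
  induction n generalizing a with
  | zero => rfl
  | succ n ih => simp only [Function.iterate_succ_apply, h.slide_mul_zpow, ih]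

/-- Inversion exchanges infimum and supremum up to sign; this symmetry lets the statement on suprema
follow from the one on infima. -/
theorem slide_inv : slide Δ x⁻¹ (-q) (-p) = slide Δ x p q := by
  funext a
  simp only [slide, inv_inv, neg_neg]
  rw [inf_comm (x⁻¹ * a * Δ ^ q)]

/-- `a⁻¹ x a` has infimum at least `p` and supremum at most `q`. -/
def Between (Δ x : G) (p q : ℤ) (a : G) : Prop := a * Δ ^ p ≤ x * a ∧ x * a ≤ a * Δ ^ q

theorem RightMono.between_mul_zpow (h : RightMono Δ) {a : G} (ha : Between Δ x p q a) (n : ℤ) :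
    Between Δ x p q (a * Δ ^ n) := by
  have h1 := h n _ _ ha.1
  have h2 := h n _ _ ha.2
  simp only [Between, mul_assoc, ← zpow_add] at *
  rw [add_comm n p, add_comm n q]
  exact ⟨h1, h2⟩

/-- `a⁻¹ x a` is periodic under sliding. -/
def Cyclic (Δ x : G) (p q : ℤ) (a : G) : Prop :=
  ∃ n : ℕ, 1 ≤ n ∧ ∃ u, Commute u x ∧ (slide Δ x p q)^[n] a = u * a

theorem RightMono.cyclic_mul_zpow (h : RightMono Δ) {a : G} (ha : Cyclic Δ x p q a) (m : ℤ) :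
    Cyclic Δ x p q (a * Δ ^ m) := by
  obtain ⟨n, hn, u, hu, hua⟩ := ha
  exact ⟨n, hn, u, hu, by rw [h.slide_iterate_mul_zpow, hua, mul_assoc]⟩

variable [MulLeftMono G]

theorem mul_inf_left (a b c : G) : a * (b ⊓ c) = a * b ⊓ a * c :=
  (OrderIso.mulLeft a).map_inf b c

theorem RightMono.slide_inf (h : RightMono Δ) (a b : G) :
    slide Δ x p q (a ⊓ b) = slide Δ x p q a ⊓ slide Δ x p q b := by
  simp only [slide, mul_inf_left, h.inf_mul, h.inf_mul_self]
  ac_rfl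

theorem RightMono.slide_monotone (h : RightMono Δ) : Monotone (slide Δ x p q) := by
  intro a b hab
  rw [← inf_eq_left] at hab ⊢
  rw [← h.slide_inf, hab]

theorem slide_mul_of_commute {u : G} (hu : Commute u x) (a : G) :
    slide Δ x p q (u * a) = u * slide Δ x p q a := by
  simp only [slide, mul_inf_left, ← mul_assoc, hu.eq, hu.inv_right.eq]

theorem RightMono.slide_iterate_inf (h : RightMono Δ) (n : ℕ) (a b : G) :
    (slide Δ x p q)^[n] (a ⊓ b) = (slide Δ x p q)^[n] a ⊓ (slide Δ x p q)^[n] b := by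
  induction n generalizing a b with
  | zero => rfl
  | succ n ih => simp only [Function.iterate_succ_apply, h.slide_inf, ih]

theorem slide_iterate_mul_of_commute {u : G} (hu : Commute u x) (n : ℕ) (a : G) :
    (slide Δ x p q)^[n] (u * a) = u * (slide Δ x p q)^[n] a := by
  induction n generalizing a with
  | zero => rfl
  | succ n ih => simp only [Function.iterate_succ_apply, slide_mul_of_commute hu, ih]

theorem slide_iterate_mul_eq {u : G} (hu : Commute u x) {n : ℕ} {a : G}
    (h : (slide Δ x p q)^[n] a = u * a) (k : ℕ) :
    (slide Δ x p q)^[n * k] a = u ^ k * a := by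
  induction k with
  | zero => simp
  | succ k ih =>
    rw [mul_add_one, Function.iterate_add_apply, h, slide_iterate_mul_of_commute hu, ih,
      ← mul_assoc, pow_succ']

/-- The lift is monotone and commutes with `x` on the left and `Δ ^ n` on the right, so it can be
applied to both sides. Hence sliding never lowers the infimum; the next lemma is the dual for the
supremum. -/
theorem RightMono.slide_mul_zpow_le (h : RightMono Δ) {n : ℤ} {a : G}
    (ha : a * Δ ^ n ≤ x * a) :
    slide Δ x p q a * Δ ^ n ≤ x * slide Δ x p q a := by
  rw [← h.slide_mul_zpow, ← slide_mul_of_commute (Commute.refl x)]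
  exact h.slide_monotone ha

theorem RightMono.le_slide_mul_zpow (h : RightMono Δ) {n : ℤ} {a : G}
    (ha : x * a ≤ a * Δ ^ n) :
    x * slide Δ x p q a ≤ slide Δ x p q a * Δ ^ n := by
  rw [← h.slide_mul_zpow, ← slide_mul_of_commute (Commute.refl x)]
  exact h.slide_monotone ha

theorem RightMono.between_inf (h : RightMono Δ) {a b : G} (ha : Between Δ x p q a)
    (hb : Between Δ x p q b) : Between Δ x p q (a ⊓ b) := by
  simp only [Between, h.inf_mul, mul_inf_left]
  exact ⟨inf_le_inf ha.1 hb.1, inf_le_inf ha.2 hb.2⟩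

/-- If no iterate of the sliding raises the infimum `p` of `x`, then `p` is maximal in the
conjugacy class of `x`. -/
theorem RightMono.not_mul_zpow_le (h : RightMono Δ) (h1 : 1 ≤ Δ) (hd : BoundedDCC G)
    (harch : ∀ a : G, ∃ n : ℤ, a * Δ ^ n ≤ 1)
    (hq : x ≤ Δ ^ q)
    (hit : ∀ k, ¬ (slide Δ x p q)^[k] 1 * Δ ^ (p + 1) ≤ x * (slide Δ x p q)^[k] 1) (a : G) :
    ¬ a * Δ ^ (p + 1) ≤ x * a := by
  intro ha
  -- Fixed points of `K` are exactly the conjugators giving infimum at least `p + 1`. `K` only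
  -- decreases, so iterating from `1` above the fixed point `a * Δ ^ n` must stop at another fixed
  -- point.
  set K : G → G := fun a => x * a * Δ ^ (-(p + 1)) ⊓ a with hK
  set L : G → G := fun a => x⁻¹ * a * Δ ^ (q - 1) ⊓ a with hL
  have hKmono : Monotone K := fun b c hbc =>
    inf_le_inf (h _ _ _ (mul_le_mul_right hbc x)) hbc
  have hfix : ∀ b, b * Δ ^ (p + 1) ≤ x * b ↔ K b = b := by
    intro b
    rw [hK, inf_eq_right, ← h.mul_le_iff (-(p + 1)), mul_assoc, ← zpow_add, add_neg_cancel,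
      zpow_zero, mul_one]
  obtain ⟨n, hn⟩ := harch a
  have han : K (a * Δ ^ n) = a * Δ ^ n := by
    rw [← hfix]
    have := h n _ _ ha
    rw [mul_assoc, ← zpow_add] at this ⊢
    rwa [add_comm n, ← mul_assoc]
  obtain ⟨k, hk⟩ := exists_iterate_fixed hd hKmono (fun _ => inf_le_right) han hn
  -- When `q ≥ p + 2`, the lift is `L ∘ K` followed by `Δ`, and `L` and `K` commute. So `k` slidings
  -- contain `K^[k] 1`, which is fixed by `K`, and the infimum has risen.
  rcases le_or_gt (p + 2) q with hpq | hpq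
  · have hcomm : Function.Commute L K := by
      intro b
      simp only [hK, hL, mul_inf_left, h.inf_mul, mul_assoc, ← zpow_add,
        mul_inv_cancel_left, inv_mul_cancel_left]
      rw [add_comm (q - 1), inf_inf_inf_comm, inf_comm (x⁻¹ * _)]
    have hslide : ∀ b, slide Δ x p q b = L (K b) * Δ := by
      intro b
      simp only [hK, hL, slide, mul_inf_left, h.inf_mul, h.inf_mul_self, mul_assoc, ← zpow_add,
        inv_mul_cancel_left, ← zpow_add_one]
      -- Expanding `L (K b) * Δ` yields the three terms of `slide` and the extra term `b * Δ ^ (q -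
      -- p - 1)`, which is redundant because `q - p - 1 ≥ 1`.
      have hle : b * Δ ≤ b * Δ ^ (-(p + 1) + (q - 1) + 1) := by
        refine mul_le_mul_right ?_ b
        simpa using h.zpow_le_zpow h1 (show (1 : ℤ) ≤ -(p + 1) + (q - 1) + 1 by lia)
      rw [show -(p + 1) + 1 = -p by ring, show q - 1 + 1 = q by ring]
      apply le_antisymm
      · exact le_inf (le_inf (inf_le_right.trans hle) (inf_le_left.trans inf_le_right))
          (le_inf (inf_le_left.trans inf_le_left) inf_le_right)
      · exact le_inf (le_inf (inf_le_right.trans inf_le_left) (inf_le_left.trans inf_le_right))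
          (inf_le_right.trans inf_le_right)
    have hiter : ∀ m : ℕ, (slide Δ x p q)^[m] 1 = (L ∘ K)^[m] 1 * Δ ^ (m : ℤ) := by
      intro m
      induction m with
      | zero => simp
      | succ m ih =>
        rw [Function.iterate_succ_apply', Function.iterate_succ_apply', ih, h.slide_mul_zpow,
          hslide, mul_assoc, ← zpow_one_add, add_comm, Function.comp_apply, Nat.cast_succ]
    apply hit k
    have hfixed : K ((L ∘ K)^[k] 1) = (L ∘ K)^[k] 1 := by
      rw [hcomm.comp_iterate, Function.comp_apply, ← (hcomm.iterate_left k) (K^[k] 1), hk]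
    rw [← hfix] at hfixed
    rw [hiter, mul_assoc, ← zpow_add, add_comm, zpow_add, ← mul_assoc, ← mul_assoc]
    exact h _ _ _ hfixed
  -- Here `q ≤ p + 1`, so the first term of `K` is always the smaller along the orbit of `1`.
  -- Stationarity then forces `x = Δ ^ (p + 1)`, excluded already before any sliding.
  · have hxle : x ≤ Δ ^ (p + 1) := hq.trans (h.zpow_le_zpow h1 (by lia))
    have hiter : ∀ m : ℕ, K^[m] 1 = x ^ m * Δ ^ (-(p + 1) * m) := by
      intro m
      induction m with
      | zero => simp
      | succ m ih =>
        have h2 := h (-(p + 1) * (m + 1)) _ _ (mul_le_mul_right hxle (x ^ m))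
        rw [mul_assoc, mul_assoc, ← zpow_add, ← mul_assoc] at h2
        rw [Function.iterate_succ_apply', ih]
        simp only [hK]
        rw [← mul_assoc x, mul_assoc, ← zpow_add, ← pow_succ', pow_succ, inf_eq_left.2]
        · congr 2
          push_cast; ring
        · convert h2 using 3 <;> ring
    have hk2 := hiter (k + 1)
    rw [Function.iterate_succ_apply', hk, hiter, pow_succ, mul_assoc, mul_right_inj] at hk2
    apply hit 0
    have hx : x = Δ ^ (p + 1) := by
      rw [Nat.cast_succ, mul_add_one, add_comm (_ * _), zpow_add, ← mul_assoc] at hk2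
      have h3 : x * Δ ^ (-(p + 1)) = 1 := right_eq_mul.1 hk2
      rw [zpow_neg] at h3
      exact mul_inv_eq_one.1 h3
    simp [hx]

/-- The map `b ↦ v⁻¹ * f^[n] b` is monotone and fixes every power of `Δ`, so it preserves the
interval between two such powers. That interval is finite, and the map is injective on the elements
that `f^[n]` moves by the centralizer of `x`; hence `a` is periodic under it. -/
theorem RightMono.exists_iterate_eq (h : RightMono Δ)
    (hlow : ∀ a : G, ∃ m : ℤ, Δ ^ m ≤ a) (hup : ∀ a : G, ∃ m : ℤ, a ≤ Δ ^ m)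
    (hfin : ∀ m n : ℤ, {a : G | Δ ^ m ≤ a ∧ a ≤ Δ ^ n}.Finite) {n : ℕ} {v : G}
    (hv : Commute v x) (hv1 : (slide Δ x p q)^[n] 1 = v) {a u : G} (hu : Commute u x)
    (ha : (slide Δ x p q)^[n] a = u * a) :
    ∃ k : ℕ, 1 ≤ k ∧ (slide Δ x p q)^[n * k] a = v ^ k * a := by
  obtain ⟨m₁, hm₁⟩ := hlow a
  obtain ⟨m₂, hm₂⟩ := hup a
  set f := slide Δ x p q with hf
  have hpow : ∀ m : ℤ, v⁻¹ * f^[n] (Δ ^ m) = Δ ^ m := fun m => by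
    rw [hf, ← one_mul (Δ ^ m), h.slide_iterate_mul_zpow, ← hf, hv1, inv_mul_cancel_left, one_mul]
  have hmono : Monotone fun b => v⁻¹ * f^[n] b := fun b c hbc =>
    mul_le_mul_right (h.slide_monotone.iterate n hbc) _
  set A : Set G := {b | (Δ ^ m₁ ≤ b ∧ b ≤ Δ ^ m₂) ∧ ∃ u, Commute u x ∧ f^[n] b = u * b} with hA
  have hAfin : A.Finite := (hfin m₁ m₂).subset fun b hb => hb.1
  have hmaps : ∀ b ∈ A, v⁻¹ * f^[n] b ∈ A := by
    rintro b ⟨⟨hb1, hb2⟩, w, hw, hwb⟩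
    refine ⟨⟨(hpow m₁).ge.trans (hmono hb1), (hmono hb2).trans (hpow m₂).le⟩,
      v⁻¹ * w * v, (hv.inv_left.mul_left hw).mul_left hv, ?_⟩
    rw [hwb, ← mul_assoc, hf, slide_iterate_mul_of_commute (hv.inv_left.mul_left hw), ← hf, hwb]
    group
  have : Finite A := hAfin
  let Φ : A → A := fun b => ⟨v⁻¹ * f^[n] b, hmaps b b.2⟩
  have hinj : Function.Injective Φ := by
    rintro ⟨b, hb, w, hw, hwb⟩ ⟨c, hc, w', hw', hwc⟩ hbc
    have hbc' : w * b = w' * c := by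
      have := mul_left_cancel (congrArg Subtype.val hbc)
      simpa only [hwb, hwc] using this
    -- Applying `f^[n]` once more to `w * b = w' * c` and cancelling gives `w = w'`, hence `b = c`.
    have h3 : w * (w * b) = w' * (w' * c) := by
      have h4 := congrArg (f^[n]) hbc'
      rwa [hf, slide_iterate_mul_of_commute hw, slide_iterate_mul_of_commute hw', ← hf, hwb, hwc]
        at h4
    rw [hbc'] at h3
    obtain rfl := mul_right_cancel h3
    exact Subtype.ext (mul_left_cancel hbc')
  obtain ⟨k, hk, hper⟩ := hinj.mem_periodicPts ⟨a, ⟨hm₁, hm₂⟩, u, hu, ha⟩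
  refine ⟨k, hk, ?_⟩
  have hiter : ∀ (j : ℕ) (b : A), (Φ^[j] b : G) = v⁻¹ ^ j * f^[n * j] b := by
    intro j
    induction j with
    | zero => simp
    | succ j ih =>
      intro b
      rw [Function.iterate_succ_apply, ih, mul_add_one, Function.iterate_add_apply, hf,
        slide_iterate_mul_of_commute hv.inv_left, pow_succ, mul_assoc]
  have h5 := congrArg Subtype.val hper
  rw [hiter] at h5
  rwa [inv_pow, inv_mul_eq_iff_eq_mul] at h5

theorem RightMono.cyclic_inf (h : RightMono Δ)
    (hlow : ∀ a : G, ∃ m : ℤ, Δ ^ m ≤ a) (hup : ∀ a : G, ∃ m : ℤ, a ≤ Δ ^ m)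
    (hfin : ∀ m n : ℤ, {a : G | Δ ^ m ≤ a ∧ a ≤ Δ ^ n}.Finite)
    (h1 : Cyclic Δ x p q 1) {a b : G} (ha : Cyclic Δ x p q a) (hb : Cyclic Δ x p q b) :
    Cyclic Δ x p q (a ⊓ b) := by
  obtain ⟨n, hn, v, hv, hv1⟩ := h1
  obtain ⟨n₁, hn₁, u₁, hu₁, ha⟩ := ha
  obtain ⟨n₂, hn₂, u₂, hu₂, hb⟩ := hb
  have hv1' := slide_iterate_mul_eq hv hv1 (n₁ * n₂)
  have ha' := slide_iterate_mul_eq hu₁ ha (n * n₂)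
  have hb' := slide_iterate_mul_eq hu₂ hb (n * n₁)
  rw [mul_one] at hv1'
  rw [show n₁ * (n * n₂) = n * (n₁ * n₂) by ring] at ha'
  rw [show n₂ * (n * n₁) = n * (n₁ * n₂) by ring] at hb'
  have hV := hv.pow_left (n₁ * n₂)
  obtain ⟨k₁, hk₁, ha''⟩ :=
    h.exists_iterate_eq hlow hup hfin hV hv1' (hu₁.pow_left _) ha'
  obtain ⟨k₂, hk₂, hb''⟩ :=
    h.exists_iterate_eq hlow hup hfin hV hv1' (hu₂.pow_left _) hb'
  have ha3 := slide_iterate_mul_eq (hV.pow_left k₁) ha'' k₂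
  have hb3 := slide_iterate_mul_eq (hV.pow_left k₂) hb'' k₁
  rw [← pow_mul, mul_assoc] at ha3 hb3
  rw [mul_comm k₂] at hb3
  refine ⟨n * (n₁ * n₂) * (k₁ * k₂), by simp only [Nat.one_le_iff_ne_zero] at *; positivity, _,
    hV.pow_left (k₁ * k₂), ?_⟩
  rw [h.slide_iterate_inf, mul_assoc n, ← mul_assoc n, ha3, hb3, mul_inf_left]

end OrderedGroup

end Garside

namespace Garside

/-! ### Divisibility and finiteness in the monoid -/

section Monoid

variable {M : Type*} [Monoid M]

theorem exists_mul_eq_of_closure_eq_top {T : Set M} (hT : Submonoid.closure T = ⊤) (b : M)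
    (hb : b ≠ 1) : ∃ t ∈ T, t ≠ 1 ∧ ∃ c, t * c = b := by
  have hmem : b ∈ Submonoid.closure T := hT ▸ Submonoid.mem_top b
  induction hmem using Submonoid.closure_induction_left with
  | one => exact absurd rfl hb
  | mul_left t ht y _ ih =>
    by_cases h1 : t = 1
    · subst h1
      rw [one_mul] at hb ⊢
      exact ih hb
    · exact ⟨t, ht, h1, y, rfl⟩

theorem finite_setOf_norm_le [Monoid.FG M] {ν : M → ℕ} (h1 : ∀ a, ν a = 0 ↔ a = 1)
    (hmul : ∀ a b, ν a + ν b ≤ ν (a * b)) (n : ℕ) : {a | ν a ≤ n}.Finite := by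
  obtain ⟨T, hT⟩ := (Monoid.fg_def.1 ‹Monoid.FG M› : (⊤ : Submonoid M).FG)
  induction n with
  | zero =>
    refine (Set.finite_singleton (1 : M)).subset fun a ha => ?_
    exact (h1 a).1 (Nat.le_zero.1 ha)
  | succ n ih =>
    refine ((Set.finite_singleton (1 : M)).union (T.finite_toSet.image2 (· * ·) ih)).subset
      fun a ha => ?_
    by_cases ha1 : a = 1
    · exact Or.inl ha1
    · obtain ⟨t, ht, ht1, c, rfl⟩ := exists_mul_eq_of_closure_eq_top hT a ha1
      refine Or.inr ⟨t, ht, c, ?_, rfl⟩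
      have := hmul t c
      have := mt (h1 t).1 ht1
      simp only [Set.mem_ofPred_eq] at ha ⊢
      lia

variable {Δ : M}

theorem IsGarsideElement.exists_eq_mul (hΔ : IsGarsideElement Δ) (b : M) :
    ∃ a, Δ * a = b * Δ := by
  have hmem : b ∈ Submonoid.closure {a | LeL a Δ} := hΔ.closure_eq_top ▸ Submonoid.mem_top b
  induction hmem using Submonoid.closure_induction with
  | mem s hs =>
    obtain ⟨a, ha⟩ := hΔ.exists_tau_symm ⟨s, hs⟩
    exact ⟨a, ha⟩
  | one => exact ⟨1, by simp⟩
  | mul a b _ _ iha ihb =>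
    obtain ⟨a', ha⟩ := iha
    obtain ⟨b', hb⟩ := ihb
    exact ⟨a' * b', by rw [← mul_assoc, ha, mul_assoc, hb, mul_assoc]⟩

theorem IsGarsideElement.exists_leL_pow (hΔ : IsGarsideElement Δ) (a : M) :
    ∃ n : ℕ, LeL a (Δ ^ n) := by
  have hmem : a ∈ Submonoid.closure {a | LeL a Δ} := hΔ.closure_eq_top ▸ Submonoid.mem_top a
  induction hmem using Submonoid.closure_induction_right with
  | one => exact ⟨0, 1, by simp⟩
  | mul_right a _ s hs ih =>
    obtain ⟨n, c, hc⟩ := ih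
    obtain ⟨s', hs'⟩ := hs
    obtain ⟨c', hc'⟩ := hΔ.exists_eq_mul c
    refine ⟨n + 1, s' * c', ?_⟩
    rw [pow_succ, ← hc, mul_assoc a c, ← hc', ← hs']
    simp only [mul_assoc]

variable [IsGarsideMonoid M]

theorem IsGarsideElement.exists_mul_eq (hΔ : IsGarsideElement Δ) (a : M) :
    ∃ b, Δ * a = b * Δ := by
  have hmem : a ∈ Submonoid.closure {a | LeL a Δ} := hΔ.closure_eq_top ▸ Submonoid.mem_top a
  induction hmem using Submonoid.closure_induction with
  | mem s hs => exact ⟨_, tau_spec hΔ ⟨s, hs⟩⟩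
  | one => exact ⟨1, by simp⟩
  | mul a b _ _ iha ihb =>
    obtain ⟨a', ha⟩ := iha
    obtain ⟨b', hb⟩ := ihb
    exact ⟨a' * b', by rw [← mul_assoc, ha, mul_assoc, hb, mul_assoc]⟩

theorem IsGarsideElement.exists_leR_pow (hΔ : IsGarsideElement Δ) (a : M) :
    ∃ n : ℕ, LeR a (Δ ^ n) := by
  have hmem : a ∈ Submonoid.closure {a | LeL a Δ} := hΔ.closure_eq_top ▸ Submonoid.mem_top a
  induction hmem using Submonoid.closure_induction_left with
  | one => exact ⟨0, 1, by simp⟩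
  | mul_left s hs a _ ih =>
    obtain ⟨n, c, hc⟩ := ih
    obtain ⟨s', hs'⟩ := (hΔ.leL_iff_leR s).1 hs
    obtain ⟨c', hc'⟩ := hΔ.exists_mul_eq c
    refine ⟨n + 1, c' * s', ?_⟩
    rw [pow_succ', ← hc, ← mul_assoc Δ c, hc', ← hs']
    simp only [mul_assoc]

/-- The set of all elements of a Garside monoid satisfies the left Ore condition. -/
noncomputable instance : OreLocalization.OreSet (⊤ : Submonoid M) where
  ore_right_cancel r₁ r₂ s h := ⟨1, by rw [mul_right_cancel h]⟩
  oreNum r s :=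
    Classical.choose (Classical.choose_spec ((IsGarsideMonoid.latticeR (M := M)).exists_join r s)).2.1
  oreDenom r s :=
    ⟨Classical.choose (Classical.choose_spec
      ((IsGarsideMonoid.latticeR (M := M)).exists_join r s)).1, trivial⟩
  ore_eq r s :=
    (Classical.choose_spec (Classical.choose_spec
      ((IsGarsideMonoid.latticeR (M := M)).exists_join r s)).1).trans
    (Classical.choose_spec (Classical.choose_spec
      ((IsGarsideMonoid.latticeR (M := M)).exists_join r (s : M))).2.1).symm

end Monoid

/-! ### The group of fractions as a meet-semilattice -/

section FractionGroup

variable {M : Type*} [Monoid M]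

theorem pow_add_mul_eq_incl {Δ : M} {n : ℕ} {g : FractionGroup M} {a : M}
    (h : incl M Δ ^ n * g = incl M a) (k : ℕ) :
    incl M Δ ^ (k + n) * g = incl M (Δ ^ k * a) := by
  rw [pow_add, mul_assoc, h, map_mul, map_pow]

variable [IsGarsideMonoid M]

open OreLocalization in
-- The presented group maps to the units of the Ore localization at the whole monoid, where
-- cancellativity keeps elements of `M` distinct.
theorem incl_injective : Function.Injective (incl M) := by
  let f : M → (OreLocalization (⊤ : Submonoid M) M)ˣ := fun a => numeratorUnit ⟨a, trivial⟩
  have hf : ∀ a b, f a * f b = f (a * b) := fun a b =>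
    Units.ext (map_mul (numeratorHom (S := (⊤ : Submonoid M))) a b).symm
  have hrel : ∀ r ∈ {w : FreeGroup M | ∃ a b c : M, a * b = c ∧
      w = FreeGroup.of a * FreeGroup.of b * (FreeGroup.of c)⁻¹}, FreeGroup.lift f r = 1 := by
    rintro _ ⟨a, b, _, rfl, rfl⟩
    simp [hf]
  intro a b hab
  have h1 : f a = f b := by
    have := congrArg (PresentedGroup.toGroup hrel) hab
    simpa only [incl, MonoidHom.coe_mk, OneHom.coe_mk, PresentedGroup.toGroup.of] using this
  have h2 : (a /ₒ (1 : (⊤ : Submonoid M))) = b /ₒ (1 : (⊤ : Submonoid M)) := congrArg Units.val h1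
  rw [oreDiv_eq_iff] at h2
  obtain ⟨u, v, huv, huv'⟩ := h2
  have huv2 : (u : M) = v := by simpa using huv'
  subst huv2
  exact (mul_left_cancel (huv : (u : M) * b = u * a)).symm

/-- The left divisibility relation on the group of fractions. -/
def FracLe (g h : FractionGroup M) : Prop := ∃ m : M, g * incl M m = h

theorem fracLe_antisymm {g h : FractionGroup M} (h1 : FracLe g h) (h2 : FracLe h g) : g = h := by
  obtain ⟨a, rfl⟩ := h1
  obtain ⟨b, hb⟩ := h2
  have hab : a * b = 1 := by
    rw [mul_assoc, ← map_mul, mul_eq_left, ← map_one (incl M)] at hb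
    exact incl_injective hb
  obtain ⟨ν, h0, hmul⟩ := IsGarsideMonoid.atomic (M := M)
  have h3 := hmul a b
  rw [hab, (h0 1).2 rfl] at h3
  rw [(h0 a).1 (by lia), map_one, mul_one]

variable {Δ : M}

theorem IsGarsideElement.exists_zpow_mul_eq (hΔ : IsGarsideElement Δ) (n : ℤ) (a : M) :
    ∃ b, incl M Δ ^ n * incl M a = incl M b * incl M Δ ^ n := by
  induction n generalizing a with
  | zero => exact ⟨a, by simp⟩
  | succ n ih =>
    obtain ⟨b, hb⟩ := hΔ.exists_mul_eq a
    obtain ⟨c, hc⟩ := ih b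
    refine ⟨c, ?_⟩
    rw [zpow_add_one, mul_assoc, ← map_mul, hb, map_mul, ← mul_assoc, hc, mul_assoc]
  | pred n ih =>
    obtain ⟨b, hb⟩ := hΔ.exists_eq_mul a
    obtain ⟨c, hc⟩ := ih b
    refine ⟨c, ?_⟩
    have h1 : (incl M Δ)⁻¹ * incl M a = incl M b * (incl M Δ)⁻¹ := by
      rw [inv_mul_eq_iff_eq_mul, ← mul_assoc, ← map_mul, hb, map_mul, mul_inv_cancel_right]
    rw [zpow_sub_one, mul_assoc, h1, ← mul_assoc, hc, mul_assoc]

theorem IsGarsideElement.exists_pow_mul_eq_incl (hΔ : IsGarsideElement Δ) (g : FractionGroup M) :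
    ∃ (n : ℕ) (a : M), incl M Δ ^ n * g = incl M a := by
  have hmem : g ∈ Subgroup.closure (Set.range (incl M)) := by
    change g ∈ Subgroup.closure (Set.range PresentedGroup.of)
    rw [PresentedGroup.closure_range_of]
    trivial
  induction hmem using Subgroup.closure_induction_left with
  | one => exact ⟨0, 1, by simp⟩
  | mul_left x hx y _ ih =>
    obtain ⟨x, rfl⟩ := hx
    obtain ⟨n, a, ha⟩ := ih
    obtain ⟨x', hx'⟩ := hΔ.exists_zpow_mul_eq n x
    refine ⟨n, x' * a, ?_⟩
    rw [zpow_natCast] at hx'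
    rw [map_mul, ← ha, ← mul_assoc (incl M x'), ← hx', mul_assoc]
  | inv_mul_cancel x hx y _ ih =>
    obtain ⟨x, rfl⟩ := hx
    obtain ⟨n, a, ha⟩ := ih
    obtain ⟨k, c, hc⟩ := hΔ.exists_leR_pow x
    obtain ⟨c', hc'⟩ := hΔ.exists_zpow_mul_eq n c
    rw [zpow_natCast] at hc'
    refine ⟨n + k, c' * a, ?_⟩
    rw [map_mul, ← ha, ← mul_assoc (incl M c'), ← hc', pow_add, ← map_pow (incl M) Δ k, ← hc,
      map_mul, mul_assoc, mul_assoc, mul_assoc, mul_inv_cancel_left]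

theorem leL_of_fracLe {a b : M} {g h w : FractionGroup M} (ha : w * g = incl M a)
    (hb : w * h = incl M b) (hgh : FracLe g h) : LeL a b := by
  obtain ⟨m, rfl⟩ := hgh
  refine ⟨m, incl_injective ?_⟩
  rw [map_mul, ← ha, ← hb, mul_assoc]

/-- A power of `Δ` moves both elements into `M`, where meets exist. -/
theorem exists_isMeet_fracLe (g h : FractionGroup M) : ∃ d, IsMeet FracLe g h d := by
  obtain ⟨Δ, hΔ⟩ := IsGarsideMonoid.exists_garsideElement (M := M)
  obtain ⟨n₁, a, ha⟩ := hΔ.exists_pow_mul_eq_incl g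
  obtain ⟨n₂, b, hb⟩ := hΔ.exists_pow_mul_eq_incl h
  obtain ⟨n, a, b, ha, hb⟩ : ∃ (n : ℕ) (a b : M), incl M Δ ^ n * g = incl M a ∧
      incl M Δ ^ n * h = incl M b :=
    ⟨n₂ + n₁, _, _, pow_add_mul_eq_incl ha n₂,
      by rw [add_comm]; exact pow_add_mul_eq_incl hb n₁⟩
  obtain ⟨⟨c₁, h₁⟩, ⟨c₂, h₂⟩, h₃⟩ := isMeet_meetL a b
  refine ⟨(incl M Δ ^ n)⁻¹ * incl M (meetL a b), ⟨c₁, ?_⟩, ⟨c₂, ?_⟩, fun e hea heb => ?_⟩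
  · rw [mul_assoc, ← map_mul, h₁, ← ha, inv_mul_cancel_left]
  · rw [mul_assoc, ← map_mul, h₂, ← hb, inv_mul_cancel_left]
  obtain ⟨k, e', he⟩ := hΔ.exists_pow_mul_eq_incl e
  have he2 := pow_add_mul_eq_incl he n
  rw [add_comm] at he2
  have h4 := leL_of_fracLe he2 (pow_add_mul_eq_incl ha k) hea
  have h5 := leL_of_fracLe he2 (pow_add_mul_eq_incl hb k) heb
  -- A lower bound `e` may need a further factor `Δ ^ k` to enter `M`. The meet of `Δ ^ k * a` and
  -- `Δ ^ k * b` is a multiple `Δ ^ k * d`, and cancelling shows that `d` divides both `a` and `b`.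
  obtain ⟨⟨d₁, g₁⟩, ⟨d₂, g₂⟩, g₃⟩ := isMeet_meetL (Δ ^ k * a) (Δ ^ k * b)
  obtain ⟨d, hd⟩ := g₃ (Δ ^ k) ⟨a, rfl⟩ ⟨b, rfl⟩
  obtain ⟨c, hc⟩ := g₃ _ h4 h5
  rw [← hd, mul_assoc] at g₁ g₂
  obtain ⟨f, hf⟩ := h₃ d ⟨d₁, mul_left_cancel g₁⟩ ⟨d₂, mul_left_cancel g₂⟩
  refine ⟨c * f, ?_⟩
  rw [eq_inv_mul_iff_mul_eq, ← mul_right_inj (incl M Δ ^ k), ← mul_assoc, ← mul_assoc, ← pow_add,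
    he2, ← map_mul, ← mul_assoc, hc, ← hd, mul_assoc, hf, map_mul, map_pow]

noncomputable instance : SemilatticeInf (FractionGroup M) where
  le := FracLe
  le_refl g := ⟨1, by simp⟩
  le_trans := by
    rintro g _ _ ⟨a, rfl⟩ ⟨b, rfl⟩
    exact ⟨a * b, by rw [map_mul, mul_assoc]⟩
  le_antisymm _ _ := fracLe_antisymm
  inf g h := Classical.choose (exists_isMeet_fracLe g h)
  inf_le_left g h := (Classical.choose_spec (exists_isMeet_fracLe g h)).1
  inf_le_right g h := (Classical.choose_spec (exists_isMeet_fracLe g h)).2.1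
  le_inf e g h := (Classical.choose_spec (exists_isMeet_fracLe g h)).2.2 e

theorem frac_le_iff {g h : FractionGroup M} : g ≤ h ↔ ∃ m : M, g * incl M m = h := Iff.rfl

instance : MulLeftMono (FractionGroup M) :=
  ⟨fun g => by
    rintro h _ ⟨m, rfl⟩
    exact ⟨m, mul_assoc _ _ _⟩⟩

theorem incl_le_incl {a b : M} : incl M a ≤ incl M b ↔ LeL a b := by
  rw [frac_le_iff]
  simp only [← map_mul, incl_injective.eq_iff]
  rfl

theorem one_le_incl (a : M) : 1 ≤ incl M a := ⟨a, one_mul _⟩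

theorem one_le_iff_exists {g : FractionGroup M} : 1 ≤ g ↔ ∃ a : M, g = incl M a := by
  simp only [frac_le_iff, one_mul, eq_comm]

theorem incl_meetL (a b : M) : incl M (meetL a b) = incl M a ⊓ incl M b := by
  obtain ⟨h₁, h₂, h₃⟩ := isMeet_meetL a b
  apply le_antisymm
  · exact le_inf (incl_le_incl.2 h₁) (incl_le_incl.2 h₂)
  · obtain ⟨c, hc⟩ := one_le_iff_exists.1 (le_inf (one_le_incl a) (one_le_incl b))
    rw [hc, incl_le_incl]
    exact h₃ c (incl_le_incl.1 (hc ▸ inf_le_left)) (incl_le_incl.1 (hc ▸ inf_le_right))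

theorem IsGarsideElement.rightMono (hΔ : IsGarsideElement Δ) : RightMono (incl M Δ) := by
  rintro n g _ ⟨a, rfl⟩
  obtain ⟨b, hb⟩ := hΔ.exists_zpow_mul_eq (-n) a
  refine ⟨b, ?_⟩
  rw [zpow_neg, inv_mul_eq_iff_eq_mul, ← mul_assoc, eq_mul_inv_iff_mul_eq] at hb
  rw [mul_assoc, mul_assoc, hb]

theorem IsGarsideElement.exists_zpow_le (hΔ : IsGarsideElement Δ) (g : FractionGroup M) :
    ∃ m : ℤ, incl M Δ ^ m ≤ g := by
  obtain ⟨n, a, ha⟩ := hΔ.exists_pow_mul_eq_incl g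
  refine ⟨-n, a, ?_⟩
  rw [← ha, zpow_neg, zpow_natCast, inv_mul_cancel_left]

theorem IsGarsideElement.exists_le_zpow (hΔ : IsGarsideElement Δ) (g : FractionGroup M) :
    ∃ m : ℤ, g ≤ incl M Δ ^ m := by
  obtain ⟨n, a, ha⟩ := hΔ.exists_pow_mul_eq_incl g
  obtain ⟨k, c, hc⟩ := hΔ.exists_leL_pow a
  refine ⟨-n + k, c, ?_⟩
  rw [zpow_add, zpow_natCast, ← map_pow (incl M) Δ k, ← hc, map_mul, ← ha, zpow_neg, zpow_natCast,
    mul_assoc, inv_mul_cancel_left]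

theorem IsGarsideElement.exists_mul_zpow_le_one (hΔ : IsGarsideElement Δ)
    (g : FractionGroup M) : ∃ m : ℤ, g * incl M Δ ^ m ≤ 1 := by
  obtain ⟨m, hm⟩ := hΔ.exists_le_zpow g
  exact ⟨-m, by simpa using hΔ.rightMono (-m) _ _ hm⟩

/-- Write `u n = b * m n` with `m n` in `M`: the norm of `m n` drops at each strict descent. -/
theorem boundedDCC_fractionGroup : BoundedDCC (FractionGroup M) := by
  intro b u hu hb
  obtain ⟨ν, h0, hmul⟩ := IsGarsideMonoid.atomic (M := M)
  choose m hm using fun n => frac_le_iff.1 (hb n)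
  have hex : ∃ n, ¬ ν (m (n + 1)) < ν (m n) :=
    WellFounded.not_rel_apply_succ (r := (· < ·)) fun n => ν (m n)
  obtain ⟨n, hn⟩ := hex
  obtain ⟨c, hc⟩ := frac_le_iff.1 (hu n)
  have h1 : m (n + 1) * c = m n := by
    rw [← hm, ← hm, mul_assoc, mul_right_inj, ← map_mul] at hc
    exact incl_injective hc
  have h2 := hmul (m (n + 1)) c
  rw [h1] at h2
  rw [(h0 c).1 (by lia), map_one, mul_one] at hc
  exact ⟨n, hc⟩

theorem finite_setOf_leL (b : M) : {a : M | LeL a b}.Finite := by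
  obtain ⟨ν, h0, hmul⟩ := IsGarsideMonoid.atomic (M := M)
  have := IsGarsideMonoid.fg (M := M)
  refine (finite_setOf_norm_le h0 hmul (ν b)).subset ?_
  rintro a ⟨c, rfl⟩
  have := hmul a c
  simp only [Set.mem_ofPred_eq]
  lia

theorem IsGarsideElement.finite_Icc (hΔ : IsGarsideElement Δ) (m n : ℤ) :
    {g : FractionGroup M | incl M Δ ^ m ≤ g ∧ g ≤ incl M Δ ^ n}.Finite := by
  refine ((finite_setOf_leL (Δ ^ (n - m).toNat)).image
    fun a => incl M Δ ^ m * incl M a).subset ?_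
  rintro g ⟨⟨a, rfl⟩, h2⟩
  refine ⟨a, ?_, rfl⟩
  rw [Set.mem_ofPred_eq, ← incl_le_incl, map_pow, ← zpow_natCast]
  have h3 := mul_le_mul_right h2 (incl M Δ ^ (-m))
  rw [← mul_assoc, ← zpow_add, ← zpow_add, neg_add_cancel, zpow_zero, one_mul] at h3
  exact h3.trans (hΔ.rightMono.zpow_le_zpow (one_le_incl Δ) (by lia))

end FractionGroup

end Garside

namespace Garside

/-! ### Normal forms, bounds and the sliding prefix -/

section NormalForm

variable {M : Type*} [Monoid M] {Δ : M}

theorem prod_nil : prod ([] : List (Simple Δ)) = 1 := rfl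

theorem prod_cons (a : Simple Δ) (l : List (Simple Δ)) : prod (a :: l) = a * prod l := by
  simp [prod]

theorem prod_append (l l' : List (Simple Δ)) : prod (l ++ l') = prod l * prod l' := by
  simp [prod]

theorem incl_star (hΔ : IsGarsideElement Δ) (a : Simple Δ) :
    incl M (star hΔ a : M) = (incl M a)⁻¹ * incl M Δ := by
  rw [eq_inv_mul_iff_mul_eq, ← map_mul, mul_star]

variable [IsGarsideMonoid M]

theorem isNormalForm_nil : IsNormalForm ([] : List (Simple Δ)) := fun i hi => by simp at hi

theorem IsNormalForm.cons {a : Simple Δ} {l : List (Simple Δ)} (ha : (a : M) ≠ 1)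
    (hal : (a : M) = meetL Δ (prod (a :: l))) (hl : IsNormalForm l) : IsNormalForm (a :: l) := by
  intro i hi
  cases i with
  | zero => exact ⟨ha, hal⟩
  | succ i => exact hl i (by simpa using hi)

theorem IsNormalForm.incl_getElem {s : List (Simple Δ)} (hs : IsNormalForm s) {i : ℕ}
    (hi : i < s.length) :
    incl M (s[i] : M) = incl M Δ ⊓ incl M (prod (s.drop i)) := by
  rw [← incl_meetL, ← (hs i hi).2]

theorem IsNormalForm.of_append {l l' : List (Simple Δ)} (h : IsNormalForm (l ++ l')) :
    IsNormalForm l := by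
  intro i hi
  have hi' : i < (l ++ l').length := by rw [List.length_append]; lia
  have h1 := h.incl_getElem hi'
  have h2 := (h i hi').1
  rw [List.getElem_append_left hi] at h1 h2
  rw [List.drop_append_of_le_length hi.le, prod_append] at h1
  refine ⟨h2, incl_injective ?_⟩
  rw [incl_meetL]
  apply le_antisymm
  · refine le_inf (h1.le.trans inf_le_left) ?_
    rw [incl_le_incl, List.drop_eq_getElem_cons hi, prod_cons]
    exact ⟨_, rfl⟩
  · rw [h1]
    exact inf_le_inf le_rfl (incl_le_incl.2 ⟨_, rfl⟩)

theorem incl_tau_zpow (hΔ : IsGarsideElement Δ) (n : ℤ) (a : Simple Δ) :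
    incl M ((tau hΔ ^ n) a : M) = incl M Δ ^ n * incl M a * incl M Δ ^ (-n) := by
  have h1 : ∀ b : Simple Δ, incl M (tau hΔ b : M) = incl M Δ * incl M b * (incl M Δ)⁻¹ := by
    intro b
    rw [← map_mul, tau_spec hΔ b, map_mul, mul_inv_cancel_right]
  have h2 : ∀ b : Simple Δ,
      incl M ((tau hΔ)⁻¹ b : M) = (incl M Δ)⁻¹ * incl M b * incl M Δ := by
    intro b
    have := h1 ((tau hΔ)⁻¹ b)
    rw [← Equiv.Perm.mul_apply, mul_inv_cancel, Equiv.Perm.one_apply] at this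
    rw [this]
    group
  induction n generalizing a with
  | zero => simp
  | succ n ih =>
    rw [zpow_add_one, Equiv.Perm.mul_apply, ih, h1]
    group
  | pred n ih =>
    rw [zpow_sub_one, Equiv.Perm.mul_apply, ih, h2]
    group

/-- This expresses `t^*` by the whole product instead of its last factor. It is dual to the
definition of the normal form, and holds by induction since consecutive factors satisfy `b = Δ ⊓ b
c`. -/
theorem IsNormalForm.inv_mul_inf (hΔ : IsGarsideElement Δ) {l : List (Simple Δ)} {c : Simple Δ}
    (h : IsNormalForm (l ++ [c])) :
    (incl M (prod (l ++ [c])))⁻¹ * incl M Δ ^ ((l ++ [c]).length : ℤ) ⊓ incl M Δ =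
      (incl M c)⁻¹ * incl M Δ := by
  induction l using List.reverseRecOn generalizing c with
  | nil =>
    simp only [List.nil_append, prod_cons, prod_nil, mul_one, List.length_singleton,
      Nat.cast_one, zpow_one, inf_eq_left]
    rw [← incl_star hΔ, incl_le_incl]
    exact (star hΔ c).2
  | append_singleton l b ih =>
    have hb : incl M (b : M) = incl M Δ ⊓ incl M b * incl M c := by
      have := h.incl_getElem (i := l.length) (by simp)
      simpa [prod_cons, prod_nil] using this
    have h1 := ih h.of_append
    rw [prod_append (l ++ [b]), List.length_append (as := l ++ [b])]
    set W := incl M (prod (l ++ [b]))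
    set k : ℤ := ((l ++ [b]).length : ℤ)
    -- By induction the first two terms meet `Δ` in `b⁻¹ Δ`, and normality of the pair `b, c` says
    -- that `b⁻¹ Δ ⊓ c = 1`.
    have h2 : W⁻¹ * incl M Δ ^ k ⊓ incl M c = 1 := by
      have hc : incl M Δ ⊓ incl M c = incl M c := inf_eq_right.2 (incl_le_incl.2 c.2)
      rw [← hc, ← inf_assoc, h1, ← mul_right_inj (incl M (b : M)), mul_inf_left,
        mul_inv_cancel_left, ← hb, mul_one]
    have h3 := congrArg (· * incl M Δ) h2
    simp only [hΔ.rightMono.inf_mul_self, one_mul, mul_assoc] at h3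
    have h4 := congrArg ((incl M (c : M))⁻¹ * ·) h3
    simp only [mul_inf_left, inv_mul_cancel_left] at h4
    rw [← h4, prod_cons, prod_nil, mul_one, map_mul, mul_inv_rev, List.length_singleton,
      Nat.cast_add, Nat.cast_one, zpow_add_one]
    simp only [mul_assoc]
    rfl

theorem incl_prod_le (hΔ : IsGarsideElement Δ) (l : List (Simple Δ)) :
    incl M (prod l) ≤ incl M Δ ^ (l.length : ℤ) := by
  induction l with
  | nil => simp [prod_nil]
  | cons a l ih =>
    rw [prod_cons, map_mul, List.length_cons, Nat.cast_succ, add_comm, zpow_add, zpow_one]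
    exact (mul_le_mul_right ih _).trans (hΔ.rightMono _ _ _ (incl_le_incl.2 a.2))

theorem exists_isNormalForm (hΔ : IsGarsideElement Δ) (b : M) :
    ∃ l : List (Simple Δ), prod l = b ∧ IsNormalForm l := by
  obtain ⟨ν, h0, hmul⟩ := IsGarsideMonoid.atomic (M := M)
  induction hn : ν b using Nat.strong_induction_on generalizing b with
  | _ n ih =>
  by_cases hb : b = 1
  · exact ⟨[], hb ▸ prod_nil, isNormalForm_nil⟩
  obtain ⟨h1, ⟨c, hc⟩, h3⟩ := isMeet_meetL Δ b
  have hne : meetL Δ b ≠ 1 := by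
    intro h
    obtain ⟨t, ht, ht1, d, hd⟩ := exists_mul_eq_of_closure_eq_top hΔ.closure_eq_top b hb
    obtain ⟨e, he⟩ := h3 t ht ⟨d, hd⟩
    rw [h] at he
    have := hmul t e
    rw [he, (h0 1).2 rfl] at this
    exact ht1 ((h0 t).1 (by lia))
  have hlt : ν c < n := by
    have := hmul (meetL Δ b) c
    have := mt (h0 _).1 hne
    rw [hc] at *
    lia
  obtain ⟨l, hl, hnf⟩ := ih _ hlt c rfl
  have hprod : prod (⟨meetL Δ b, h1⟩ :: l : List (Simple Δ)) = b := by rw [prod_cons, hl, hc]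
  exact ⟨_, hprod, hnf.cons hne (by rw [hprod])⟩

/-- `g` has infimum `p` and supremum `q`. -/
structure HasBounds (Δ : M) (g : FractionGroup M) (p q : ℤ) : Prop where
  le : incl M Δ ^ p ≤ g
  not_le : ¬ incl M Δ ^ (p + 1) ≤ g
  ge : g ≤ incl M Δ ^ q
  not_ge : ¬ g ≤ incl M Δ ^ (q - 1)

theorem HasBounds.le_of_zpow_le {g : FractionGroup M} {p q n : ℤ} (hΔ : IsGarsideElement Δ)
    (h : HasBounds Δ g p q) (hn : incl M Δ ^ n ≤ g) : n ≤ p := by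
  by_contra! hlt
  exact h.not_le ((hΔ.rightMono.zpow_le_zpow (one_le_incl Δ) (by lia)).trans hn)

theorem HasBounds.le_of_le_zpow {g : FractionGroup M} {p q n : ℤ} (hΔ : IsGarsideElement Δ)
    (h : HasBounds Δ g p q) (hn : g ≤ incl M Δ ^ n) : q ≤ n := by
  by_contra! hlt
  exact h.not_ge (hn.trans (hΔ.rightMono.zpow_le_zpow (one_le_incl Δ) (by lia)))

theorem IsDeltaNormalForm.hasBounds (hΔ : IsGarsideElement Δ) {g : FractionGroup M} {p : ℤ}
    {s : List (Simple Δ)} (h : IsDeltaNormalForm g p s) : HasBounds Δ g p (p + s.length) := by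
  obtain ⟨rfl, hmax, hnf⟩ := h
  have hnot : ¬ incl M Δ ^ (p + 1) ≤ incl M Δ ^ p * incl M (prod s) := by
    rintro ⟨b, hb⟩
    have := hmax _ b hb.symm
    lia
  refine ⟨⟨_, rfl⟩, hnot, ?_, fun hle => ?_⟩
  · rw [zpow_add]
    exact mul_le_mul_right (incl_prod_le hΔ s) _
  · rw [add_sub_assoc, zpow_add, mul_le_mul_iff_left] at hle
    have h1 := hΔ.rightMono 1 _ _ (mul_le_mul_right hle (incl M (prod s))⁻¹)
    rw [inv_mul_cancel, one_mul, zpow_one, mul_assoc, ← zpow_add_one, sub_add_cancel] at h1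
    rcases List.eq_nil_or_concat' s with rfl | ⟨l, c, rfl⟩
    · apply hnot
      rw [zpow_add_one]
      refine mul_le_mul_right ?_ _
      simpa [prod_nil] using h1
    -- If the supremum were smaller, `Δ` would lie below `W⁻¹ Δ ^ r`, so the last factor would
    -- satisfy `c⁻¹ Δ = Δ` and be trivial.
    · rw [← inf_eq_right, hnf.inv_mul_inf hΔ, mul_eq_right, inv_eq_one, ← map_one (incl M)] at h1
      refine (hnf l.length (by simp)).1 ?_
      simpa using incl_injective h1

theorem exists_isDeltaNormalForm (hΔ : IsGarsideElement Δ) (h1 : Δ ≠ 1) (g : FractionGroup M) :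
    ∃ (p : ℤ) (s : List (Simple Δ)), IsDeltaNormalForm g p s := by
  have hR := hΔ.rightMono
  obtain ⟨m, hm⟩ := hΔ.exists_le_zpow g
  obtain ⟨p, ⟨b, hb⟩, hmax⟩ := Int.exists_greatest_of_bdd (P := fun n => incl M Δ ^ n ≤ g)
    ⟨m, fun n hn => by
      by_contra! hlt
      have h2 := hR (-m) _ _ ((hR.zpow_le_zpow (one_le_incl Δ) (by lia : m + 1 ≤ n)).trans
        (hn.trans hm))
      rw [← zpow_add, ← zpow_add, add_neg_cancel, zpow_zero, add_neg_cancel_comm, zpow_one] at h2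
      have := le_antisymm h2 (one_le_incl Δ)
      rw [← map_one (incl M)] at this
      exact h1 (incl_injective this)⟩ (hΔ.exists_zpow_le g)
  obtain ⟨s, rfl, hs⟩ := exists_isNormalForm hΔ b
  exact ⟨p, s, hb.symm, fun q β h => hmax q ⟨β, h.symm⟩, hs⟩

/-- If `Δ = 1`, every exponent represents `g` and none is maximal; the degenerate case is thus
excluded. -/
theorem IsDeltaNormalForm.ne_one {g : FractionGroup M} {p : ℤ} {s : List (Simple Δ)}
    (h : IsDeltaNormalForm g p s) : Δ ≠ 1 := by
  rintro rfl
  have := h.le_of_eq (p + 1) (prod s) (by simpa using h.eq)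
  lia

theorem deltaNormalForm_spec (hΔ : IsGarsideElement Δ) (h1 : Δ ≠ 1) (g : FractionGroup M) :
    IsDeltaNormalForm g (deltaNormalForm Δ g).1 (deltaNormalForm Δ g).2 := by
  obtain ⟨p, s, h⟩ := exists_isDeltaNormalForm hΔ h1 g
  have hex : ∃ x : ℤ × List (Simple Δ), IsDeltaNormalForm g x.1 x.2 := ⟨(p, s), h⟩
  rw [deltaNormalForm, dif_pos hex]
  exact Classical.choose_spec hex

theorem exists_hasBounds (hΔ : IsGarsideElement Δ) (h1 : Δ ≠ 1) (g : FractionGroup M) :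
    ∃ p q, HasBounds Δ g p q :=
  ⟨_, _, (deltaNormalForm_spec hΔ h1 g).hasBounds hΔ⟩

/-- Both factors are meets with `Δ`: `i(g) = Δ ⊓ g Δ ^ (-p)` and `t(g)^* = g⁻¹ Δ ^ q ⊓ Δ`. -/
theorem HasBounds.incl_slidingPrefix (hΔ : IsGarsideElement Δ) (h1 : Δ ≠ 1)
    {g : FractionGroup M} {p q : ℤ} (h : HasBounds Δ g p q) :
    incl M (slidingPrefix hΔ g) = slide (incl M Δ) g p q 1 := by
  have hR := hΔ.rightMono
  have hspec := deltaNormalForm_spec hΔ h1 g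
  rw [slidingPrefix, incl_meetL, incl_star]
  unfold initialFactor terminalFactor
  generalize deltaNormalForm Δ g = x at hspec
  obtain ⟨p', s⟩ := x
  have hb := hspec.hasBounds hΔ
  simp only at hspec hb ⊢
  obtain rfl : p' = p := le_antisymm (h.le_of_zpow_le hΔ hb.le) (hb.le_of_zpow_le hΔ h.le)
  obtain rfl : p' + s.length = q :=
    le_antisymm (hb.le_of_le_zpow hΔ h.ge) (h.le_of_le_zpow hΔ hb.ge)
  have hinv : g⁻¹ * incl M Δ ^ (p' + s.length : ℤ) =
      (incl M (prod s))⁻¹ * incl M Δ ^ (s.length : ℤ) := by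
    rw [hspec.eq, zpow_add]
    group
  simp only [slide, mul_one, one_mul]
  rw [hinv]
  rcases s with _ | ⟨a, l⟩
  -- For `r = 0` the conventions `i = 1` and `t = Δ` make both sides trivial.
  · have hg : g = incl M Δ ^ p' := by simpa [prod_nil] using hspec.eq
    simp only [List.getLastD_nil, prod_nil, map_one, Simple.one, Simple.top, hg, List.length_nil,
      Nat.cast_zero, zpow_zero, inv_mul_cancel, inv_one, mul_one, ← zpow_add, add_neg_cancel,
      le_refl, inf_of_le_left]
    exact (inf_eq_left.2 (one_le_incl Δ)).symm
  · have hi : incl M ((tau hΔ ^ p') a : M) = incl M Δ ⊓ g * incl M Δ ^ (-p') := by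
      have ha : incl M (a : M) = incl M Δ ⊓ incl M (prod (a :: l)) := by
        exact hspec.normalForm.incl_getElem (i := 0) (by simp)
      rw [incl_tau_zpow, ha, mul_inf_left, hR.inf_mul, ← hspec.eq, ← zpow_add_one, ← zpow_add]
      congr 1
      rw [add_neg_cancel_comm, zpow_one]
    obtain ⟨l', c, hc⟩ := (List.eq_nil_or_concat' (a :: l)).resolve_left (by simp)
    simp only [hi]
    have hnf := hspec.normalForm
    rw [hc] at hnf ⊢
    rw [List.getLastD_concat, ← hnf.inv_mul_inf hΔ]
    rw [inf_comm (incl M Δ), inf_assoc, inf_assoc]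
    congr 1
    rw [inf_comm, inf_assoc, inf_idem]

theorem HasBounds.sliding_conj (hΔ : IsGarsideElement Δ) (h1 : Δ ≠ 1)
    {x a : FractionGroup M} {p q : ℤ} (h : HasBounds Δ (a⁻¹ * x * a) p q) :
    sliding hΔ (a⁻¹ * x * a) =
      (slide (incl M Δ) x p q a)⁻¹ * x * slide (incl M Δ) x p q a := by
  have h2 : slide (incl M Δ) x p q a = a * slide (incl M Δ) (a⁻¹ * x * a) p q 1 := by
    simp only [slide, mul_inf_left, mul_inv_rev, inv_inv, mul_assoc, one_mul,
      mul_inv_cancel_left, mul_one]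
  rw [sliding, h.incl_slidingPrefix hΔ h1, h2]
  group

end NormalForm

end Garside

namespace Garside

/-! ### Conjugators into sliding circuits -/

section SlidingCircuits

variable {M : Type*} [Monoid M] [IsGarsideMonoid M] {Δ : M}

theorem sliding_zpow_le (hΔ : IsGarsideElement Δ) (h1 : Δ ≠ 1) {g : FractionGroup M} {n : ℤ}
    (hn : incl M Δ ^ n ≤ g) : incl M Δ ^ n ≤ sliding hΔ g := by
  obtain ⟨p, q, h⟩ := exists_hasBounds hΔ h1 g
  have h2 := hΔ.rightMono.slide_mul_zpow_le (x := g) (p := p) (q := q) (a := 1) (n := n)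
    (by simpa using hn)
  rw [sliding, h.incl_slidingPrefix hΔ h1, mul_assoc]
  simpa using mul_le_mul_right h2 (slide (incl M Δ) g p q 1)⁻¹

theorem sliding_le_zpow (hΔ : IsGarsideElement Δ) (h1 : Δ ≠ 1) {g : FractionGroup M} {n : ℤ}
    (hn : g ≤ incl M Δ ^ n) : sliding hΔ g ≤ incl M Δ ^ n := by
  obtain ⟨p, q, h⟩ := exists_hasBounds hΔ h1 g
  have h2 := hΔ.rightMono.le_slide_mul_zpow (x := g) (p := p) (q := q) (a := 1) (n := n)
    (by simpa using hn)
  rw [sliding, h.incl_slidingPrefix hΔ h1, mul_assoc]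
  simpa using mul_le_mul_right h2 (slide (incl M Δ) g p q 1)⁻¹

theorem iterate_iff_of_periodic {X : Type*} {f : X → X} {P : X → Prop}
    (hP : ∀ x, P x → P (f x)) {m : ℕ} (hm : 1 ≤ m) {x : X} (hx : f^[m] x = x) (k : ℕ) :
    P (f^[k] x) ↔ P x := by
  have hit : ∀ (j : ℕ) (y : X), P y → P (f^[j] y) := by
    intro j
    induction j with
    | zero => exact fun y hy => hy
    | succ j ih => exact fun y hy => ih _ (hP y hy)
  refine ⟨fun h => ?_, hit k x⟩
  -- After `k * m - k` further steps the orbit is back at `x`.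
  have h2 := hit (k * m - k) _ h
  rwa [← Function.iterate_add_apply, Nat.sub_add_cancel (Nat.le_mul_of_pos_right k hm), mul_comm,
    Function.iterate_mul, Function.iterate_fixed hx] at h2

/-- `g` lies on a cycle of the sliding map. -/
def IsCircuit (hΔ : IsGarsideElement Δ) (g : FractionGroup M) : Prop :=
  ∃ m : ℕ, 1 ≤ m ∧ (sliding hΔ)^[m] g = g

theorem HasBounds.sliding_iterate (hΔ : IsGarsideElement Δ) (h1 : Δ ≠ 1) {g : FractionGroup M}
    {p q : ℤ} (h : HasBounds Δ g p q) (hg : IsCircuit hΔ g) (k : ℕ) :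
    HasBounds Δ ((sliding hΔ)^[k] g) p q := by
  obtain ⟨m, hm, hmg⟩ := hg
  have hle : ∀ n : ℤ, incl M Δ ^ n ≤ (sliding hΔ)^[k] g ↔ incl M Δ ^ n ≤ g := fun n =>
    iterate_iff_of_periodic (P := fun g => incl M Δ ^ n ≤ g)
      (fun _ => sliding_zpow_le hΔ h1) hm hmg k
  have hge : ∀ n : ℤ, (sliding hΔ)^[k] g ≤ incl M Δ ^ n ↔ g ≤ incl M Δ ^ n := fun n =>
    iterate_iff_of_periodic (P := fun g => g ≤ incl M Δ ^ n)
      (fun _ => sliding_le_zpow hΔ h1) hm hmg k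
  exact ⟨(hle _).2 h.le, mt (hle _).1 h.not_le, (hge _).2 h.ge, mt (hge _).1 h.not_ge⟩

theorem sliding_iterate_conj (hΔ : IsGarsideElement Δ) (h1 : Δ ≠ 1) {x a : FractionGroup M}
    {p q : ℤ} {k : ℕ}
    (h : ∀ j < k, HasBounds Δ ((((slide (incl M Δ) x p q)^[j] a)⁻¹ * x *
      (slide (incl M Δ) x p q)^[j] a)) p q) :
    (sliding hΔ)^[k] (a⁻¹ * x * a) =
      ((slide (incl M Δ) x p q)^[k] a)⁻¹ * x * (slide (incl M Δ) x p q)^[k] a := by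
  induction k with
  | zero => rfl
  | succ k ih =>
    rw [Function.iterate_succ_apply', ih fun j hj => h j (by lia),
      (h k (by lia)).sliding_conj hΔ h1, Function.iterate_succ_apply']

/-- Bounds at earlier steps identify the lift with sliding up to step `k`; bounds are constant along
a circuit because each can only move one way. -/
theorem HasBounds.slide_iterate (hΔ : IsGarsideElement Δ) (h1 : Δ ≠ 1) {x a : FractionGroup M}
    {p q : ℤ} (h : HasBounds Δ (a⁻¹ * x * a) p q) (ha : IsCircuit hΔ (a⁻¹ * x * a)) (k : ℕ) :
    HasBounds Δ (((slide (incl M Δ) x p q)^[k] a)⁻¹ * x *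
      (slide (incl M Δ) x p q)^[k] a) p q := by
  induction k using Nat.strong_induction_on with
  | _ k ih =>
    rw [← sliding_iterate_conj hΔ h1 ih]
    exact h.sliding_iterate hΔ h1 ha k

theorem zpow_le_conj_iff {x a : FractionGroup M} {n : ℤ} :
    incl M Δ ^ n ≤ a⁻¹ * x * a ↔ a * incl M Δ ^ n ≤ x * a := by
  rw [mul_assoc, ← mul_le_mul_iff_left a, mul_inv_cancel_left]

theorem conj_le_zpow_iff {x a : FractionGroup M} {n : ℤ} :
    a⁻¹ * x * a ≤ incl M Δ ^ n ↔ x * a ≤ a * incl M Δ ^ n := by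
  rw [mul_assoc, ← mul_le_mul_iff_left a, mul_inv_cancel_left]

/-- The infimum of an element of a sliding circuit is maximal in its conjugacy class. -/
theorem IsCircuit.not_zpow_le_conj (hΔ : IsGarsideElement Δ) (h1 : Δ ≠ 1) {x : FractionGroup M}
    {p q : ℤ} (h : HasBounds Δ x p q) (hx : IsCircuit hΔ x) (a : FractionGroup M) :
    ¬ incl M Δ ^ (p + 1) ≤ a⁻¹ * x * a := by
  rw [zpow_le_conj_iff]
  refine hΔ.rightMono.not_mul_zpow_le (one_le_incl Δ) boundedDCC_fractionGroup
    hΔ.exists_mul_zpow_le_one h.ge (fun k => ?_) a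
  rw [← zpow_le_conj_iff]
  exact (HasBounds.slide_iterate hΔ h1 (a := 1) (by simpa using h) (by simpa using hx) k).not_le

/-- The supremum of an element of a sliding circuit is minimal in its conjugacy class. -/
theorem IsCircuit.not_conj_le_zpow (hΔ : IsGarsideElement Δ) (h1 : Δ ≠ 1) {x : FractionGroup M}
    {p q : ℤ} (h : HasBounds Δ x p q) (hx : IsCircuit hΔ x) (a : FractionGroup M) :
    ¬ a⁻¹ * x * a ≤ incl M Δ ^ (q - 1) := by
  have hR := hΔ.rightMono
  -- A supremum at most `q - 1` for a conjugate of `x` is an infimum at least `-q + 1` for the same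
  -- conjugate of `x⁻¹`.
  have hinv : ∀ a : FractionGroup M, a⁻¹ * x * a ≤ incl M Δ ^ (q - 1) ↔
      a * incl M Δ ^ (-q + 1) ≤ x⁻¹ * a := by
    intro a
    rw [conj_le_zpow_iff, ← mul_le_mul_iff_left x (b := a * _), mul_inv_cancel_left,
      ← hR.mul_le_iff (-q + 1), mul_assoc a, ← zpow_add, show q - 1 + (-q + 1) = 0 by ring,
      zpow_zero, mul_one, mul_assoc]
  rw [hinv]
  have hq : x⁻¹ ≤ incl M Δ ^ (-p) := by
    simpa using hR (-p) _ _ (mul_le_mul_right h.le x⁻¹)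
  refine hR.not_mul_zpow_le (one_le_incl Δ) boundedDCC_fractionGroup
    hΔ.exists_mul_zpow_le_one hq (fun k => ?_) a
  rw [slide_inv, ← hinv]
  exact (HasBounds.slide_iterate hΔ h1 (a := 1) (by simpa using h) (by simpa using hx) k).not_ge

theorem IsCircuit.hasBounds_conj (hΔ : IsGarsideElement Δ) (h1 : Δ ≠ 1) {x : FractionGroup M}
    {p q : ℤ} (h : HasBounds Δ x p q) (hx : IsCircuit hΔ x) {a : FractionGroup M}
    (ha : IsCircuit hΔ (a⁻¹ * x * a)) : HasBounds Δ (a⁻¹ * x * a) p q := by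
  obtain ⟨p', q', h'⟩ := exists_hasBounds hΔ h1 (a⁻¹ * x * a)
  have hconj : (a⁻¹)⁻¹ * (a⁻¹ * x * a) * a⁻¹ = x := by group
  have hp := ha.not_zpow_le_conj hΔ h1 h' a⁻¹
  have hq := ha.not_conj_le_zpow hΔ h1 h' a⁻¹
  rw [hconj] at hp hq
  have hmono := hΔ.rightMono
  have hp1 : p ≤ p' := by
    by_contra! hlt
    exact hp ((hmono.zpow_le_zpow (one_le_incl Δ) (by lia)).trans h.le)
  have hq1 : q' ≤ q := by
    by_contra! hlt
    exact hq (h.ge.trans (hmono.zpow_le_zpow (one_le_incl Δ) (by lia)))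
  exact ⟨(hmono.zpow_le_zpow (one_le_incl Δ) hp1).trans h'.le, hx.not_zpow_le_conj hΔ h1 h a,
    h'.ge.trans (hmono.zpow_le_zpow (one_le_incl Δ) hq1), hx.not_conj_le_zpow hΔ h1 h a⟩

theorem conj_eq_iff {G : Type*} [Group G] {x a b : G} :
    b⁻¹ * x * b = a⁻¹ * x * a ↔ ∃ u, Commute u x ∧ b = u * a := by
  constructor
  · intro h
    refine ⟨b * a⁻¹, ?_, by group⟩
    have h2 : x * (b * a⁻¹) = b * (b⁻¹ * x * b) * a⁻¹ := by group
    rw [commute_iff_eq, h2, h]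
    group
  · rintro ⟨u, hu, rfl⟩
    rw [mul_inv_rev, mul_assoc a⁻¹, ← hu.inv_left.symm.eq]
    group

/-- `Between` supplies the weak bounds, preserved by the lift, and extremality on the circuit of `x`
makes them exact; the lift with fixed `p` and `q` then computes sliding at every step. -/
theorem isCircuit_conj_iff (hΔ : IsGarsideElement Δ) (h1 : Δ ≠ 1) {x : FractionGroup M}
    {p q : ℤ} (h : HasBounds Δ x p q) (hx : IsCircuit hΔ x) (a : FractionGroup M) :
    IsCircuit hΔ (a⁻¹ * x * a) ↔
      Between (incl M Δ) x p q a ∧ Cyclic (incl M Δ) x p q a := by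
  have hR := hΔ.rightMono
  constructor
  · intro ha
    have hb := hx.hasBounds_conj hΔ h1 h ha
    refine ⟨⟨zpow_le_conj_iff.1 hb.le, conj_le_zpow_iff.1 hb.ge⟩, ?_⟩
    have hit := hb.slide_iterate hΔ h1 ha
    obtain ⟨m, hm, hma⟩ := ha
    refine ⟨m, hm, conj_eq_iff.1 ?_⟩
    rw [← sliding_iterate_conj hΔ h1 fun j _ => hit j, hma]
  · rintro ⟨hab, m, hm, u, hu, hua⟩
    refine ⟨m, hm, ?_⟩
    rw [sliding_iterate_conj hΔ h1 (p := p) (q := q), conj_eq_iff.2 ⟨u, hu, hua⟩]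
    intro j _
    have hbt : Between (incl M Δ) x p q ((slide (incl M Δ) x p q)^[j] a) := by
      induction j with
      | zero => exact hab
      | succ j ih =>
        rw [Function.iterate_succ_apply']
        have := ih (by lia)
        exact ⟨hR.slide_mul_zpow_le this.1, hR.le_slide_mul_zpow this.2⟩
    exact ⟨zpow_le_conj_iff.2 hbt.1, hx.not_zpow_le_conj hΔ h1 h _, conj_le_zpow_iff.2 hbt.2,
      hx.not_conj_le_zpow hΔ h1 h _⟩

/-- The elements conjugating `x` into a sliding circuit are closed under multiplication by powers
of `Δ`. -/
theorem IsCircuit.conj_mul_zpow (hΔ : IsGarsideElement Δ) (h1 : Δ ≠ 1) {x : FractionGroup M}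
    (hx : IsCircuit hΔ x) {a : FractionGroup M} (ha : IsCircuit hΔ (a⁻¹ * x * a)) (n : ℤ) :
    IsCircuit hΔ ((a * incl M Δ ^ n)⁻¹ * x * (a * incl M Δ ^ n)) := by
  obtain ⟨p, q, h⟩ := exists_hasBounds hΔ h1 x
  rw [isCircuit_conj_iff hΔ h1 h hx] at ha ⊢
  exact ⟨hΔ.rightMono.between_mul_zpow ha.1 n, hΔ.rightMono.cyclic_mul_zpow ha.2 n⟩

/-- The elements conjugating `x` into a sliding circuit are closed under meets. -/
theorem IsCircuit.conj_inf (hΔ : IsGarsideElement Δ) (h1 : Δ ≠ 1) {x : FractionGroup M}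
    (hx : IsCircuit hΔ x) {a b : FractionGroup M} (ha : IsCircuit hΔ (a⁻¹ * x * a))
    (hb : IsCircuit hΔ (b⁻¹ * x * b)) : IsCircuit hΔ ((a ⊓ b)⁻¹ * x * (a ⊓ b)) := by
  obtain ⟨p, q, h⟩ := exists_hasBounds hΔ h1 x
  have hone : IsCircuit hΔ (1⁻¹ * x * 1) := by simpa using hx
  rw [isCircuit_conj_iff hΔ h1 h hx] at ha hb hone ⊢
  exact ⟨hΔ.rightMono.between_inf ha.1 hb.1, hΔ.rightMono.cyclic_inf hΔ.exists_zpow_le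
    hΔ.exists_le_zpow hΔ.finite_Icc hone.2 ha.2 hb.2⟩

theorem IsConj.conj_left {G : Type*} [Group G] {x y : G} (h : IsConj x y) (a : G) :
    IsConj (a⁻¹ * x * a) y :=
  (isConj_iff.2 ⟨a, by group⟩ : IsConj (a⁻¹ * x * a) x).trans h

end SlidingCircuits

end Garside

theorem corollary4p15 {M : Type*} [Monoid M] [Garside.IsGarsideMonoid M]
    {Δ : M} (hΔ : Garside.IsGarsideElement Δ)
    (α β γ : Garside.FractionGroup M)
    (hβ : β ∈ Garside.slidingCircuits hΔ α)
    (hγ : γ⁻¹ * β * γ ∈ Garside.slidingCircuits hΔ α)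
    (p : ℤ) (s : List (Garside.Simple Δ)) (hs : Garside.IsDeltaNormalForm γ p s)
    (b : ℕ → Garside.FractionGroup M)
    (hb_zero : b 0 = (Garside.incl M Δ ^ p)⁻¹ * β * Garside.incl M Δ ^ p)
    (hb_succ : ∀ (i : ℕ) (hi : i < s.length),
      b (i + 1) = (Garside.incl M s[i])⁻¹ * b i * Garside.incl M s[i]) :
    ∀ i ≤ s.length, b i ∈ Garside.slidingCircuits hΔ α := by
  have h1 := hs.ne_one
  have hβc : Garside.IsCircuit hΔ β := hβ.2
  -- The witness is `g = Δ^p c_1 ⋯ c_i`; its complement in `γ` is carried along to use normality.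
  suffices h : ∀ i ≤ s.length, ∃ g : Garside.FractionGroup M,
      b i = g⁻¹ * β * g ∧ g * Garside.incl M (Garside.prod (s.drop i)) = γ ∧
        Garside.IsCircuit hΔ (g⁻¹ * β * g) by
    intro i hi
    obtain ⟨g, hg, -, hgc⟩ := h i hi
    rw [hg]
    exact ⟨Garside.IsConj.conj_left hβ.1 g, hgc⟩
  intro i
  induction i with
  | zero =>
    intro _
    refine ⟨Garside.incl M Δ ^ p, hb_zero, hs.eq.symm, ?_⟩
    have := hβc.conj_mul_zpow hΔ h1 (a := 1) (by simpa using hβc) p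
    rwa [one_mul] at this
  | succ i ih =>
    intro hi
    obtain ⟨g, hg, hgγ, hgc⟩ := ih (by lia)
    -- Normality at the next factor, multiplied on the left by `g`.
    have hstep : g * Garside.incl M (s[i] : M) = g * Garside.incl M Δ ^ (1 : ℤ) ⊓ γ := by
      rw [hs.normalForm.incl_getElem hi, Garside.mul_inf_left, hgγ, zpow_one]
    refine ⟨g * Garside.incl M s[i], ?_, ?_, ?_⟩
    · rw [hb_succ i hi, hg]
      group
    · rw [← hgγ, List.drop_eq_getElem_cons hi, Garside.prod_cons, map_mul, mul_assoc]
    · rw [hstep]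
      exact hβc.conj_inf hΔ h1 (hβc.conj_mul_zpow hΔ h1 hgc 1) hγ.2
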